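/- A walk on the square lattice $\mathbb Z^2$ is a finite sequence of unit steps up, down, left, right starting at the origin. A walk is *prudent* if it is self-avoiding and never steps towards an already visited vertex, i.e. no already visited vertex lies on the open ray that starts at the current vertex and points in the direction of the next step. The *box* of a walk is its minimal bounding rectangle, and a prudent walk is *two-sided* if every step ends on the top side or on the right side of the box of the walk up to and including that step. A *two-sided prudent polygon* is a two-sided prudent walk whose last vertex is adjacent to the origin, single edges being excluded; a polygon given by a walk with $2m-1$ steps has half-perimeter $m$ (the edge joining the last vertex to the first one is counted). Let $PP_2(t)=\sum_{m\ge 0} p_m t^m\in\mathbb Q[[t]]$, where $p_m$ is the number of two-sided prudent polygons of half-perimeter $m$. Then $$PP_2(t)=\frac1t\left(\frac{1-3t+t^2+3t^3}{1-t}-\sqrt{(1-t)(1-3t-t^2-t^3)}\right),$$ where the square root is the unique formal power series in $\mathbb Q[[t]]$ with constant term $1$ whose square is $(1-t)(1-3t-t^2-t^3)$. The series begins $$\begin{aligned}PP_2(t)={}&4t^2+6t^3+12t^4+28t^5+72t^6+196t^7+552t^8+1590t^9+4656t^{10}+13812t^{11}+41412t^{12}\\&+125286t^{13}+381976t^{14}+1172440t^{15}+3620024t^{16}+11235830t^{17}+35036928t^{18}\\&+109715014t^{19}+344863872t^{20}+\cdots.\end{aligned}$$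 -/

import Mathlib

namespace PrudentWalk

/-- The four unit steps of the square lattice `ℤ × ℤ`. -/
inductive Dir
  | up | down | left | right
  deriving DecidableEq

instance : Fintype Dir where
  elems := {.up, .down, .left, .right}
  complete d := by cases d <;> decide

/-- The displacement vector of a step. -/
def Dir.vec : Dir → ℤ × ℤ
  | .up => (0, 1)
  | .down => (0, -1)
  | .left => (-1, 0)
  | .right => (1, 0)

/-- Nearest neighbours on the square lattice. -/
def Adj (p q : ℤ × ℤ) : Prop := ∃ d : Dir, q = p + d.vec

/-- A nearest neighbour walk that starts at the origin is given by its list of steps;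
`vertex w k` is the vertex reached after `k` steps (meaningful for `k ≤ w.length`). -/
def vertex (w : List Dir) (k : ℕ) : ℤ × ℤ := ((w.take k).map Dir.vec).sum

def IsSelfAvoiding (w : List Dir) : Prop :=
  ∀ i j : ℕ, i < j → j ≤ w.length → vertex w i ≠ vertex w j

/-- A prudent walk: a self-avoiding walk that never steps towards an already occupied vertex,
i.e. no vertex visited so far lies on the open ray that starts at the current vertex and points
in the direction of the next step. -/
def IsPrudent (w : List Dir) : Prop :=
  IsSelfAvoiding w ∧
    ∀ (k : ℕ) (hk : k < w.length) (j : ℕ), j ≤ k → ∀ r : ℕ, 0 < r →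
      vertex w k + r • (w[k]).vec ≠ vertex w j

/-- Ordinate of the top side of the box (minimal bounding rectangle) of the first `k` steps. -/
def boxTop (w : List Dir) (k : ℕ) : ℤ :=
  (Finset.range (k + 1)).sup' Finset.nonempty_range_add_one fun i => (vertex w i).2

/-- Abscissa of the right side of the box (minimal bounding rectangle) of the first `k` steps. -/
def boxRight (w : List Dir) (k : ℕ) : ℤ :=
  (Finset.range (k + 1)).sup' Finset.nonempty_range_add_one fun i => (vertex w i).1

/-- Every step ends on the top side or on the right side of the current box. -/
def IsTwoSided (w : List Dir) : Prop :=
  ∀ k : ℕ, 1 ≤ k → k ≤ w.length →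
    (vertex w k).2 = boxTop w k ∨ (vertex w k).1 = boxRight w k

/-- A two-sided prudent polygon: a two-sided prudent walk, not a single edge, whose last vertex is
adjacent to its first one. -/
def IsTwoSidedPolygon (w : List Dir) : Prop :=
  IsPrudent w ∧ IsTwoSided w ∧ w.length ≠ 1 ∧ Adj (vertex w 0) (vertex w w.length)

/-- The two-sided prudent polygons of half-perimeter `m`. The perimeter consists of the steps of
the walk and of the edge that joins its last vertex to its first one. -/
def twoSidedPolygons (m : ℕ) : Set (List Dir) :=
  {w | IsTwoSidedPolygon w ∧ w.length + 1 = 2 * m}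

/-- So the cardinality below is a genuine count. -/
theorem finite_twoSidedPolygons (m : ℕ) : (twoSidedPolygons m).Finite :=
  (List.finite_length_le Dir (2 * m)).subset fun w hw => by
    have := hw.2
    simp only [Set.mem_ofPred_eq]
    omega

/-- The half-perimeter generating function of two-sided prudent polygons. -/
noncomputable def PP₂ : PowerSeries ℚ :=
  PowerSeries.mk fun m => ((twoSidedPolygons m).ncard : ℚ)

end PrudentWalk

/-! The last vertex of a polygon is a neighbour of the origin. It cannot be `(0, -1)`
(`IsTwoSidedPrudent.endpoint_ne_down`), nor by diagonal symmetry `(-1, 0)`; the same symmetry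
exchanges the endpoints `(0, 1)` and `(1, 0)`. So the count is twice that of the polygons ending at
`(0, 1)`.

A case analysis on one-step extensions (`IsTwoSidedPrudent.shape`) leaves two families of such
polygons: a hook, which goes `a` steps left, one up and `a` right, one for each half-perimeter `a +
1` with `a ≥ 1`; and a loop, which follows a path without left steps, weakly below the axis, from
the origin to `(n, 0)`, then goes one step up and `n` left. The path may be any one that never turns
back vertically: it is prudent because its endpoint is extremal in the last column.

Such a path is an `Excursion`. First return decomposition gives `N = X + (2X + X²)N + X²N²`, where
`N` counts by horizontal plus up steps, which is the half-perimeter of the loop minus one. Hence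
`PP₂ = 2XN + 2X²/(1 - X)`. The discriminant of the quadratic is `(1 - 2X - X²)² - 4X³ = (1 - X)(1 -
3X - X² - X³)`, and solving for `N` gives the formula. -/

namespace PrudentWalk

/-! ### Visited vertices under concatenation. -/

/-- The last vertex of a walk. -/
def endpoint (w : List Dir) : ℤ × ℤ := vertex w w.length

/-- The set of vertices visited by a walk. -/
def visited (w : List Dir) : Set (ℤ × ℤ) := {p | ∃ j ≤ w.length, vertex w j = p}

/-- Prudent walks all of whose steps end on the top or right side of the current box. -/
def IsTwoSidedPrudent (w : List Dir) : Prop := IsPrudent w ∧ IsTwoSided w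

theorem vertex_append_of_le {u v : List Dir} {k : ℕ} (h : k ≤ u.length) :
    vertex (u ++ v) k = vertex u k := by
  simp only [vertex, List.take_append_of_le_length h]

@[simp]
theorem vertex_zero (w : List Dir) : vertex w 0 = 0 := by simp [vertex]

theorem endpoint_eq_sum (w : List Dir) : endpoint w = (w.map Dir.vec).sum := by
  simp [endpoint, vertex]

@[simp]
theorem endpoint_nil : endpoint [] = 0 := by simp [endpoint]

theorem endpoint_append (u v : List Dir) : endpoint (u ++ v) = endpoint u + endpoint v := by
  simp [endpoint_eq_sum]

@[simp]
theorem endpoint_append_singleton (w : List Dir) (d : Dir) :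
    endpoint (w ++ [d]) = endpoint w + d.vec := by
  simp [endpoint_eq_sum]

theorem endpoint_cons (d : Dir) (w : List Dir) : endpoint (d :: w) = d.vec + endpoint w := by
  simp [endpoint_eq_sum]

theorem endpoint_replicate (n : ℕ) (d : Dir) : endpoint (List.replicate n d) = n • d.vec := by
  simp [endpoint_eq_sum]

theorem zero_mem_visited (w : List Dir) : (0 : ℤ × ℤ) ∈ visited w :=
  ⟨0, Nat.zero_le _, vertex_zero w⟩

theorem endpoint_mem_visited (w : List Dir) : endpoint w ∈ visited w := ⟨_, le_rfl, rfl⟩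

theorem vertex_length_append_singleton (w : List Dir) (d : Dir) :
    vertex (w ++ [d]) (w.length + 1) = endpoint w + d.vec := by
  have := endpoint_append_singleton w d
  simpa [endpoint] using this

theorem mem_visited_append_singleton {w : List Dir} {d : Dir} {p : ℤ × ℤ} :
    p ∈ visited (w ++ [d]) ↔ p ∈ visited w ∨ p = endpoint w + d.vec := by
  constructor
  · rintro ⟨j, hj, rfl⟩
    rw [List.length_append, List.length_singleton] at hj
    rcases Nat.lt_or_ge w.length j with h | h
    · obtain rfl : j = w.length + 1 := by omega
      exact Or.inr (vertex_length_append_singleton w d)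
    · exact Or.inl ⟨j, h, (vertex_append_of_le h).symm⟩
  · rintro (⟨j, hj, rfl⟩ | rfl)
    · exact ⟨j, by simp; omega, vertex_append_of_le hj⟩
    · exact ⟨w.length + 1, by simp, vertex_length_append_singleton w d⟩

theorem mem_visited_append_left {u v : List Dir} {p : ℤ × ℤ} (h : p ∈ visited u) :
    p ∈ visited (u ++ v) := by
  obtain ⟨j, hj, rfl⟩ := h
  exact ⟨j, by simp; omega, vertex_append_of_le hj⟩

theorem mem_visited_nil {p : ℤ × ℤ} : p ∈ visited [] ↔ p = 0 := by
  simp [visited, vertex, eq_comm]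

theorem forall_mem_visited_append {P : ℤ × ℤ → Prop} (u v : List Dir) :
    (∀ p ∈ visited (u ++ v), P p) ↔
      (∀ p ∈ visited u, P p) ∧ ∀ p ∈ visited v, P (endpoint u + p) := by
  induction v using List.reverseRecOn with
  | nil =>
    simp only [List.append_nil, mem_visited_nil, forall_eq, add_zero]
    exact ⟨fun h => ⟨h, h _ (endpoint_mem_visited u)⟩, fun h => h.1⟩
  | append_singleton v d ih =>
    simp only [← List.append_assoc, mem_visited_append_singleton, or_imp, forall_and, forall_eq,
      ih, endpoint_append, and_assoc, add_assoc]

theorem forall_mem_visited_cons {P : ℤ × ℤ → Prop} (d : Dir) (v : List Dir) :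
    (∀ p ∈ visited (d :: v), P p) ↔ P 0 ∧ ∀ p ∈ visited v, P (d.vec + p) := by
  have h := forall_mem_visited_append (P := P) [d] v
  have h1 : ∀ p, p ∈ visited [d] ↔ p = 0 ∨ p = d.vec := fun p => by
    simpa [mem_visited_nil] using mem_visited_append_singleton (w := []) (d := d) (p := p)
  simp only [List.singleton_append, h1, or_imp, forall_and, forall_eq, endpoint_cons,
    endpoint_nil, add_zero] at h
  rw [h]
  exact ⟨fun h => ⟨h.1.1, h.2⟩, fun h => ⟨⟨h.1, by simpa using h.2 0 (zero_mem_visited v)⟩, h.2⟩⟩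

/-! ### One-step extensions of two-sided prudent walks. -/

theorem isPrudent_append_singleton {w : List Dir} {d : Dir} :
    IsPrudent (w ++ [d]) ↔
      IsPrudent w ∧ ∀ r : ℕ, 0 < r → endpoint w + r • d.vec ∉ visited w := by
  constructor
  · rintro ⟨hs, hp⟩
    refine ⟨⟨fun i j hij hj => ?_, fun k hk j hj r hr => ?_⟩, ?_⟩
    · have := hs i j hij (by simp; omega)
      rwa [vertex_append_of_le (by omega), vertex_append_of_le hj] at this
    · have := hp k (by simp; omega) j hj r hr
      rwa [vertex_append_of_le (by omega), vertex_append_of_le (by omega),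
        List.getElem_append_left hk] at this
    · rintro r hr ⟨j, hj, h⟩
      have := hp w.length (by simp) j hj r hr
      rw [vertex_append_of_le le_rfl, vertex_append_of_le hj] at this
      simp only [List.getElem_concat_length] at this
      exact this h.symm
  · rintro ⟨⟨hs, hp⟩, hr⟩
    refine ⟨fun i j hij hj => ?_, fun k hk j hj r hr' => ?_⟩
    · rw [List.length_append, List.length_singleton] at hj
      rcases Nat.lt_or_ge w.length j with h | h
      · obtain rfl : j = w.length + 1 := by omega
        rw [vertex_length_append_singleton, vertex_append_of_le (by omega)]
        intro he
        exact hr 1 one_pos ⟨i, by omega, by simpa using he⟩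
      · rw [vertex_append_of_le (by omega), vertex_append_of_le h]
        exact hs i j hij h
    · rw [List.length_append, List.length_singleton] at hk
      rcases Nat.lt_or_ge k w.length with h | h
      · rw [vertex_append_of_le (by omega), vertex_append_of_le (by omega),
          List.getElem_append_left h]
        exact hp k h j hj r hr'
      · obtain rfl : k = w.length := by omega
        rw [vertex_append_of_le le_rfl, vertex_append_of_le hj]
        simp only [List.getElem_concat_length]
        exact fun he => hr r hr' ⟨j, hj, he.symm⟩

theorem snd_eq_boxTop_iff {w : List Dir} {k : ℕ} :
    (vertex w k).2 = boxTop w k ↔ ∀ i ≤ k, (vertex w i).2 ≤ (vertex w k).2 := by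
  simp only [boxTop]
  constructor
  · intro h i hi
    rw [h]
    exact Finset.le_sup' (fun i => (vertex w i).2) (by simp; omega)
  · intro h
    exact le_antisymm (Finset.le_sup' (fun i => (vertex w i).2) (by simp))
      (Finset.sup'_le _ _ fun i hi => h i (by simp at hi; omega))

theorem fst_eq_boxRight_iff {w : List Dir} {k : ℕ} :
    (vertex w k).1 = boxRight w k ↔ ∀ i ≤ k, (vertex w i).1 ≤ (vertex w k).1 := by
  simp only [boxRight]
  constructor
  · intro h i hi
    rw [h]
    exact Finset.le_sup' (fun i => (vertex w i).1) (by simp; omega)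
  · intro h
    exact le_antisymm (Finset.le_sup' (fun i => (vertex w i).1) (by simp))
      (Finset.sup'_le _ _ fun i hi => h i (by simp at hi; omega))

theorem isTwoSided_iff {w : List Dir} :
    IsTwoSided w ↔ ∀ k ≤ w.length, (∀ i ≤ k, (vertex w i).2 ≤ (vertex w k).2) ∨
      ∀ i ≤ k, (vertex w i).1 ≤ (vertex w k).1 := by
  simp only [IsTwoSided, snd_eq_boxTop_iff, fst_eq_boxRight_iff]
  refine ⟨fun h k hk => ?_, fun h k _ hk => h k hk⟩
  rcases Nat.eq_zero_or_pos k with rfl | h0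
  · left
    intro i hi
    obtain rfl : i = 0 := by omega
    rfl
  · exact h k h0 hk

theorem isTwoSided_append_singleton {w : List Dir} {d : Dir} :
    IsTwoSided (w ++ [d]) ↔ IsTwoSided w ∧
      ((∀ q ∈ visited w, q.2 ≤ (endpoint w + d.vec).2) ∨
        ∀ q ∈ visited w, q.1 ≤ (endpoint w + d.vec).1) := by
  have key : ∀ f : ℤ × ℤ → ℤ,
      (∀ i ≤ w.length + 1, f (vertex (w ++ [d]) i) ≤ f (vertex (w ++ [d]) (w.length + 1))) ↔
        ∀ q ∈ visited w, f q ≤ f (endpoint w + d.vec) := by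
    intro f
    rw [vertex_length_append_singleton]
    constructor
    · rintro h _ ⟨j, hj, rfl⟩
      simpa only [vertex_append_of_le hj] using h j (by omega)
    · intro h i hi
      rcases Nat.lt_or_ge w.length i with h' | h'
      · obtain rfl : i = w.length + 1 := by omega
        rw [vertex_length_append_singleton]
      · rw [vertex_append_of_le h']
        exact h _ ⟨i, h', rfl⟩
  simp only [isTwoSided_iff, List.length_append, List.length_singleton]
  constructor
  · intro h
    refine ⟨fun k hk => ?_, ?_⟩
    · refine (h k (by omega)).imp (fun h i hi => ?_) (fun h i hi => ?_) <;>
      · have := h i hi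
        rwa [vertex_append_of_le (by omega), vertex_append_of_le (by omega)] at this
    · exact (h _ le_rfl).imp (key Prod.snd).1 (key Prod.fst).1
  · rintro ⟨h, h'⟩ k hk
    rcases Nat.lt_or_ge w.length k with h0 | h0
    · obtain rfl : k = w.length + 1 := by omega
      exact h'.imp (key Prod.snd).2 (key Prod.fst).2
    · refine (h k h0).imp (fun h i hi => ?_) (fun h i hi => ?_) <;>
      · rw [vertex_append_of_le (by omega), vertex_append_of_le (by omega)]
        exact h i hi

theorem isTwoSidedPrudent_append_singleton {w : List Dir} {d : Dir} :
    IsTwoSidedPrudent (w ++ [d]) ↔ IsTwoSidedPrudent w ∧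
      (∀ r : ℕ, 0 < r → endpoint w + r • d.vec ∉ visited w) ∧
      ((∀ q ∈ visited w, q.2 ≤ (endpoint w + d.vec).2) ∨
        ∀ q ∈ visited w, q.1 ≤ (endpoint w + d.vec).1) := by
  simp only [IsTwoSidedPrudent, isPrudent_append_singleton, isTwoSided_append_singleton]
  tauto

theorem isTwoSidedPrudent_nil : IsTwoSidedPrudent [] := by
  refine ⟨⟨fun i j hij hj => ?_, fun k hk => ?_⟩, fun k hk hk' => ?_⟩
  · simp at hj; omega
  · simp at hk
  · simp at hk'; omega

theorem IsTwoSidedPrudent.eq_nil_of_endpoint_eq_zero {w : List Dir} (hw : IsTwoSidedPrudent w)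
    (h : endpoint w = 0) : w = [] := by
  by_contra hne
  exact hw.1.1 0 w.length (List.length_pos_iff.2 hne) le_rfl (by simpa [endpoint] using h.symm)

theorem IsTwoSidedPrudent.top_or_right {w : List Dir} (hw : IsTwoSidedPrudent w) :
    (∀ q ∈ visited w, q.2 ≤ (endpoint w).2) ∨ ∀ q ∈ visited w, q.1 ≤ (endpoint w).1 := by
  refine (isTwoSided_iff.1 hw.2 w.length le_rfl).imp ?_ ?_ <;>
  · rintro h _ ⟨j, hj, rfl⟩
    exact h j hj

/-- `d.Ahead p q`: the vertex `q` lies on the open ray from `p` in direction `d`. -/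
def Dir.Ahead : Dir → ℤ × ℤ → ℤ × ℤ → Prop
  | .up, p, q => q.1 = p.1 ∧ p.2 < q.2
  | .down, p, q => q.1 = p.1 ∧ q.2 < p.2
  | .left, p, q => q.2 = p.2 ∧ q.1 < p.1
  | .right, p, q => q.2 = p.2 ∧ p.1 < q.1

theorem Dir.ahead_iff {d : Dir} {p q : ℤ × ℤ} :
    d.Ahead p q ↔ ∃ r : ℕ, 0 < r ∧ p + r • d.vec = q := by
  obtain ⟨a, b⟩ := p
  obtain ⟨x, y⟩ := q
  cases d <;> simp only [Dir.Ahead, Dir.vec, Prod.smul_mk, Prod.mk_add_mk, Prod.mk.injEq,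
    smul_zero, add_zero, nsmul_eq_mul, mul_one, mul_neg]
  · exact ⟨fun h => ⟨(y - b).toNat, by omega, by omega, by omega⟩, fun ⟨r, h⟩ => by omega⟩
  · exact ⟨fun h => ⟨(b - y).toNat, by omega, by omega, by omega⟩, fun ⟨r, h⟩ => by omega⟩
  · exact ⟨fun h => ⟨(a - x).toNat, by omega, by omega, by omega⟩, fun ⟨r, h⟩ => by omega⟩
  · exact ⟨fun h => ⟨(x - a).toNat, by omega, by omega, by omega⟩, fun ⟨r, h⟩ => by omega⟩

theorem isTwoSidedPrudent_append_iff {w : List Dir} {d : Dir} :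
    IsTwoSidedPrudent (w ++ [d]) ↔ IsTwoSidedPrudent w ∧
      (∀ q ∈ visited w, ¬ d.Ahead (endpoint w) q) ∧
      ((∀ q ∈ visited w, q.2 ≤ (endpoint w).2 + d.vec.2) ∨
        ∀ q ∈ visited w, q.1 ≤ (endpoint w).1 + d.vec.1) := by
  rw [isTwoSidedPrudent_append_singleton]
  refine and_congr_right fun _ => and_congr ?_ Iff.rfl
  simp only [Dir.ahead_iff]
  exact ⟨fun h q hq ⟨r, hr, he⟩ => h r hr (he ▸ hq), fun h r hr hq => h _ hq ⟨r, hr, rfl⟩⟩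

/-! ### Classification of the walks that end at `(0, 1)`. -/

/-- Two consecutive steps that are not a vertical turn back. -/
def NoVerticalReversal (a b : Dir) : Prop :=
  ¬ (a = .up ∧ b = .down) ∧ ¬ (a = .down ∧ b = .up)

/-- Walks without left steps and without vertical reversals that stay weakly below the origin. -/
structure IsRightward (w : List Dir) : Prop where
  ne_left : ∀ d ∈ w, d ≠ .left
  chain : w.IsChain NoVerticalReversal
  fst_le : ∀ p ∈ visited w, p.1 ≤ (endpoint w).1
  snd_le : ∀ p ∈ visited w, p.2 ≤ 0

/-- Configurations from which a two-sided prudent walk cannot be completed to end at `(0, 1)`. -/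
def IsDead (w : List Dir) : Prop :=
  endpoint w ≠ (0, 1) ∧
    ((∃ p ∈ visited w, 2 ≤ p.2) ∨ (0, 1) ∈ visited w ∨
      ((endpoint w).2 = 1 ∧ (endpoint w).1 < 0 ∧ ((endpoint w).1 + 1, 1) ∈ visited w) ∨
      ∃ n : ℤ, 0 ≤ n ∧ (n, 1) ∈ visited w ∧ n < (endpoint w).1)

/-- Being dead is absorbing, so a dead walk never reaches `(0, 1)`. Each alternative persists or
turns into another one: a walk heading left along ordinate `1` can only continue left or rise to
ordinate `2`, and a walk to the right of `(n, 1)` cannot come back past it. -/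
theorem IsTwoSidedPrudent.isDead_append {w : List Dir} {d : Dir}
    (hg : IsTwoSidedPrudent (w ++ [d])) (hw : IsDead w) : IsDead (w ++ [d]) := by
  have hnil := (isTwoSidedPrudent_append_iff.1 hg).1.eq_nil_of_endpoint_eq_zero
  obtain ⟨hg', hray, hbox⟩ := isTwoSidedPrudent_append_iff.1 hg
  have hbox' := hg'.top_or_right
  have h0 := zero_mem_visited w
  have he := endpoint_mem_visited w
  obtain ⟨hne, h⟩ := hw
  -- With a vertex of ordinate at least `2`, a step to `(0, 1)` must end on the right side, so no
  -- visited abscissa is positive. From `(0, 2)` the step would point at the origin; from `(-1, 1)`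
  -- the walk would already be on neither side of its box.
  have hrise : ∀ p ∈ visited w, 2 ≤ p.2 → IsDead (w ++ [d]) := by
    intro p hp h2
    refine ⟨fun hend => ?_, Or.inl ⟨p, mem_visited_append_left hp, h2⟩⟩
    rw [endpoint_append_singleton] at hend
    have hz : (endpoint w) ≠ 0 := by
      intro hz
      have := hnil hz
      subst this
      rw [mem_visited_nil] at hp
      subst hp
      simp at h2
    generalize endpoint w = e at *
    obtain ⟨x, y⟩ := e
    have r0 := hray _ h0
    have b1 := hbox.imp (fun h => h p hp) (fun h => h _ he)
    have b2 := hbox'.imp (fun h => h p hp) (fun h => h _ h0)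
    cases d <;> simp [Dir.vec, Dir.Ahead, Prod.ext_iff] at hend r0 b1 b2 hz <;> omega
  rcases h with ⟨p, hp, h2⟩ | h1 | ⟨hy, hx, hm⟩ | ⟨n, hn, hm, hlt⟩
  · exact hrise p hp h2
  · refine ⟨fun hend => ?_, Or.inr (Or.inl (mem_visited_append_left h1))⟩
    refine hray _ h1 (Dir.ahead_iff.2 ⟨1, one_pos, ?_⟩)
    rw [one_smul, ← endpoint_append_singleton, hend]
  · have r1 := hray _ hm
    have b1 := hbox.imp (fun h => h _ he) (fun h => h _ h0)
    have hend := endpoint_append_singleton w d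
    have hn := endpoint_mem_visited (w ++ [d])
    have he' : endpoint w ∈ visited (w ++ [d]) := mem_visited_append_left he
    unfold IsDead
    generalize endpoint (w ++ [d]) = e' at *
    generalize endpoint w = e at *
    obtain ⟨x, y⟩ := e
    subst hend
    simp only at hy hx
    subst hy
    cases d
    · exact ⟨by simp [Dir.vec], Or.inl ⟨_, hn, by simp [Dir.vec]⟩⟩
    · simp [Dir.vec] at b1; omega
    · refine ⟨by simp [Dir.vec]; omega, Or.inr (Or.inr (Or.inl ⟨by simp [Dir.vec], ?_, ?_⟩))⟩
      · simp [Dir.vec]; omega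
      · simpa [Dir.vec] using he'
    · simp [Dir.Ahead] at r1
  -- If no ordinate exceeds `1`, a left step back to abscissa `n` must end on the top side, hence
  -- runs along ordinate `1` straight at `(n, 1)`.
  · by_cases hup : ∃ p ∈ visited w, 2 ≤ p.2
    · obtain ⟨p, hp, h2⟩ := hup
      exact hrise p hp h2
    push Not at hup
    have r1 := hray _ hm
    have b1 := hbox.imp (fun h => h _ hm) (fun h => h _ he)
    have u1 := hup _ he
    have hend := endpoint_append_singleton w d
    have hlt' : n < (endpoint (w ++ [d])).1 := by
      rw [hend]
      generalize endpoint w = e at *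
      obtain ⟨x, y⟩ := e
      cases d <;> simp [Dir.vec, Dir.Ahead] at * <;> omega
    refine ⟨fun h => ?_, Or.inr (Or.inr (Or.inr ⟨n, hn, mem_visited_append_left hm, hlt'⟩))⟩
    rw [h] at hlt'
    simp at hlt'
    omega

theorem isRightward_nil : IsRightward [] where
  ne_left := by simp
  chain := by simp
  fst_le := by simp [mem_visited_nil]
  snd_le := by simp [mem_visited_nil]

theorem IsRightward.append {w : List Dir} {d : Dir} (hw : IsRightward w)
    (hg : IsTwoSidedPrudent (w ++ [d])) (hd : d ≠ .left) (hy : (endpoint w).2 + d.vec.2 ≤ 0) :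
    IsRightward (w ++ [d]) := by
  obtain ⟨hg', hray, hbox⟩ := isTwoSidedPrudent_append_iff.1 hg
  refine ⟨?_, ?_, ?_, ?_⟩
  · simp only [List.mem_append, List.mem_singleton]
    rintro c (hc | rfl)
    · exact hw.ne_left c hc
    · exact hd
  · rw [List.isChain_append]
    refine ⟨hw.chain, by simp, ?_⟩
    simp only [List.head?_cons, Option.mem_some_iff, forall_eq']
    intro c hc
    -- After a vertical reversal the vertex before the last step would lie on the ray.
    obtain ⟨v, rfl⟩ := List.mem_getLast?_eq_getLast hc |>.elim fun hne h =>
      (⟨w.dropLast, by rw [h, List.dropLast_append_getLast]⟩ : ∃ v, w = v ++ [c])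
    have := hray _ (mem_visited_append_left (endpoint_mem_visited v))
    rw [endpoint_append_singleton] at this
    refine ⟨?_, ?_⟩
    · rintro ⟨rfl, rfl⟩
      exact this (by simp [Dir.Ahead, Dir.vec])
    · rintro ⟨rfl, rfl⟩
      exact this (by simp [Dir.Ahead, Dir.vec])
  · intro p hp
    rw [mem_visited_append_singleton] at hp
    rw [endpoint_append_singleton]
    rcases hp with hp | rfl
    · have := hw.fst_le p hp
      have h1 : 0 ≤ d.vec.1 := by cases d <;> simp [Dir.vec] at hd ⊢
      simp only [Prod.fst_add]
      omega
    · rfl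
  · intro p hp
    rw [mem_visited_append_singleton] at hp
    rcases hp with hp | rfl
    · exact hw.snd_le p hp
    · exact hy

/-- Shapes of the two-sided prudent walks that may be completed to end at `(0, 1)`. -/
inductive Shape : List Dir → Prop
  | rightward {w : List Dir} (h : IsRightward w) : Shape w
  | up : Shape [.up]
  | left (a : ℕ) (ha : 1 ≤ a) : Shape (List.replicate a .left)
  | hook {w : List Dir} (a j : ℕ) (ha : 1 ≤ a) (hj : j ≤ a)
      (hw : w = List.replicate a .left ++ [.up] ++ List.replicate j .right) : Shape w
  | closing {w : List Dir} (e : List Dir) (n j : ℕ) (h : IsRightward e) (hn : 1 ≤ n) (hj : j ≤ n)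
      (he : endpoint e = ((n : ℤ), 0)) (hw : w = e ++ [.up] ++ List.replicate j .left) : Shape w
  | dead {w : List Dir} (h : IsDead w) : Shape w

/-- Induction on the last step: from each shape, every direction is either forbidden by the ray or
the box, or leads to a shape again. -/
theorem IsTwoSidedPrudent.shape {w : List Dir} (hw : IsTwoSidedPrudent w) : Shape w := by
  induction w using List.reverseRecOn with
  | nil => exact .rightward isRightward_nil
  | append_singleton w d ih =>
    obtain ⟨hg', hray, hbox⟩ := isTwoSidedPrudent_append_iff.1 hw
    have h0 := zero_mem_visited w
    have he := endpoint_mem_visited w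
    have hend := endpoint_append_singleton w d
    have hlast := endpoint_mem_visited (w ++ [d])
    have r0 := hray _ h0
    have b0 := hbox.imp (fun h => h _ h0) (fun h => h _ h0)
    have b0e := hbox.imp (fun h => h _ he) (fun h => h _ h0)
    cases ih hg' with
    | rightward h =>
      have hy := h.snd_le _ he
      have hx := h.fst_le _ h0
      by_cases hz : endpoint w = 0
      · obtain rfl := hg'.eq_nil_of_endpoint_eq_zero hz
        cases d
        · exact .up
        · exact .rightward (h.append hw (by simp) (by simp [Dir.vec]))
        · exact .left 1 le_rfl
        · exact .rightward (h.append hw (by simp) (by simp [Dir.vec]))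
      cases d
      · by_cases hlt : (endpoint w).2 < 0
        · exact .rightward (h.append hw (by simp) (by simp [Dir.vec]; omega))
        · have hpos : 0 < (endpoint w).1 := by
            by_contra hn
            exact hz (Prod.ext (by simp at *; omega) (by simp; omega))
          exact .closing w (endpoint w).1.toNat 0 h (by omega) (by omega)
            (Prod.ext (by simp; omega) (by simp; omega)) (by simp)
      · exact .rightward (h.append hw (by simp) (by simp [Dir.vec]; omega))
      -- A left step does not end on the right side, so it must end on the top side. This forces
      -- ordinate `0` and positive abscissa, and the origin is then ahead.
      · exfalso
        generalize endpoint w = e at *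
        obtain ⟨x, y⟩ := e
        simp [Dir.vec, Dir.Ahead] at *
        have b1 := hbox.imp (fun h => h _ _ h0) (fun h => h _ _ he)
        simp at b1
        omega
      · exact .rightward (h.append hw (by simp) (by simpa [Dir.vec] using hy))
    | up =>
      refine .dead ⟨?_, Or.inr (Or.inl (mem_visited_append_left he))⟩
      rw [hend]
      cases d <;> simp [endpoint_eq_sum, Dir.vec]
    | left a ha =>
      simp only [endpoint_replicate] at *
      cases d
      · exact .hook a 0 ha (by omega) (by simp)
      · simp [Dir.vec] at b0; omega
      · rw [← List.replicate_succ']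
        exact .left (a + 1) (by omega)
      · simp [Dir.vec, Dir.Ahead] at r0; omega
    | hook a j ha hj hwe =>
      have hcorner : ((-a : ℤ), (1 : ℤ)) ∈ visited w := hwe ▸
        mem_visited_append_left (mem_visited_append_singleton.2 (Or.inr (by
          simp [endpoint_replicate, Dir.vec])))
      have hpos : endpoint w = ((j : ℤ) - a, 1) := by
        simp [hwe, endpoint_append, endpoint_replicate, Dir.vec, endpoint_cons]
        ring
      have rc := hray _ hcorner
      rw [hpos] at he hend r0 b0e rc
      cases d
      · exact .dead ⟨by simp [hend, Dir.vec], Or.inl ⟨_, hlast, by simp [hend, Dir.vec]⟩⟩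
      · exfalso
        simp [Dir.vec, Dir.Ahead] at b0e r0
        omega
      · have hj0 : j = 0 := by
          simp [Dir.Ahead] at rc
          omega
        subst hj0
        refine .dead ⟨by simp [hend, Dir.vec]; omega,
          Or.inr (Or.inr (Or.inl ⟨by simp [hend, Dir.vec],
          by simp [hend, Dir.vec]; omega, mem_visited_append_left ?_⟩))⟩
        simpa [hend, Dir.vec] using he
      · rcases Nat.lt_or_ge j a with h | h
        · exact .hook a (j + 1) ha h (by simp [hwe, List.replicate_succ'])
        · obtain rfl : j = a := by omega
          refine .dead ⟨by simp [hend, Dir.vec], Or.inr (Or.inl (mem_visited_append_left ?_))⟩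
          simpa using he
    | closing e n j h hn hj hne hwe =>
      have hcorner : ((n : ℤ), (1 : ℤ)) ∈ visited w := hwe ▸
        mem_visited_append_left (mem_visited_append_singleton.2 (Or.inr (by
          simp [hne, Dir.vec])))
      have hbelow : ((n : ℤ), (0 : ℤ)) ∈ visited w := hwe ▸
        mem_visited_append_left (mem_visited_append_left (hne ▸ endpoint_mem_visited e))
      have hpos : endpoint w = ((n : ℤ) - j, 1) := by
        simp [hwe, endpoint_append, endpoint_replicate, Dir.vec, endpoint_cons, hne]
        ring
      have rc := hray _ hcorner
      have rb := hray _ hbelow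
      have bc := hbox.imp (fun h => h _ hcorner) (fun h => h _ hcorner)
      rw [hpos] at he hend rc rb bc
      cases d
      · exact .dead ⟨by simp [hend, Dir.vec], Or.inl ⟨_, hlast, by simp [hend, Dir.vec]⟩⟩
      · exfalso
        simp [Dir.vec, Dir.Ahead] at bc rb
        omega
      · rcases Nat.lt_or_ge j n with h' | h'
        · exact .closing e n (j + 1) h hn h' hne (by simp [hwe, List.replicate_succ'])
        · obtain rfl : j = n := by omega
          refine .dead ⟨by simp [hend, Dir.vec], Or.inr (Or.inl (mem_visited_append_left ?_))⟩
          simpa using he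
      · have hj0 : j = 0 := by
          simp [Dir.Ahead] at rc
          omega
        subst hj0
        exact .dead ⟨by simp [hend, Dir.vec]; omega, Or.inr (Or.inr (Or.inr ⟨n, by omega,
          mem_visited_append_left hcorner, by simp [hend, Dir.vec]⟩))⟩
    | dead h => exact .dead (hw.isDead_append h)

theorem IsTwoSidedPrudent.eq_of_endpoint_eq {w : List Dir} (hw : IsTwoSidedPrudent w)
    (hend : endpoint w = (0, 1)) (hlen : w.length ≠ 1) :
    (∃ a : ℕ, 1 ≤ a ∧ w = List.replicate a .left ++ [.up] ++ List.replicate a .right) ∨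
      ∃ (e : List Dir) (n : ℕ), IsRightward e ∧ 1 ≤ n ∧ endpoint e = ((n : ℤ), 0) ∧
        w = e ++ [.up] ++ List.replicate n .left := by
  cases hw.shape with
  | rightward h =>
    have := h.snd_le _ (endpoint_mem_visited w)
    simp [hend] at this
  | up => simp at hlen
  | left a ha => simp [endpoint_replicate, Dir.vec] at hend
  | hook a j ha hj hwe =>
    obtain rfl : j = a := by
      simp [hwe, endpoint_append, endpoint_replicate, Dir.vec, endpoint_cons] at hend
      omega
    exact Or.inl ⟨j, ha, hwe⟩
  | closing e n j h hn hj he hwe =>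
    obtain rfl : j = n := by
      simp [hwe, endpoint_append, endpoint_replicate, Dir.vec, endpoint_cons, he] at hend
      omega
    exact Or.inr ⟨e, j, h, hn, he, hwe⟩
  | dead h => exact absurd hend h.1

/-- The origin is higher, so the last step must end on the right side and no abscissa is positive.
From `(0, -2)` the origin is ahead, and `(-1, -1)` lies on neither side of the box. -/
theorem IsTwoSidedPrudent.endpoint_ne_down {w : List Dir} (hw : IsTwoSidedPrudent w)
    (hlen : w.length ≠ 1) : endpoint w ≠ (0, -1) := by
  intro hend
  rcases List.eq_nil_or_concat' w with rfl | ⟨w, d, rfl⟩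
  · simp [Prod.ext_iff] at hend
  obtain ⟨hg', hray, hbox⟩ := isTwoSidedPrudent_append_iff.1 hw
  have h0 := zero_mem_visited w
  have he := endpoint_mem_visited w
  have hbox' := hg'.top_or_right
  have hz : endpoint w ≠ 0 := fun hz => hlen (by simp [hg'.eq_nil_of_endpoint_eq_zero hz])
  rw [endpoint_append_singleton] at hend
  generalize endpoint w = e at *
  obtain ⟨x, y⟩ := e
  have r0 := hray _ h0
  have b0 := hbox.imp (fun h => h _ h0) (fun h => h _ he)
  have b1 := hbox'.imp (fun h => h _ h0) (fun h => h _ h0)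
  cases d <;> simp [Dir.vec, Dir.Ahead, Prod.ext_iff] at * <;> omega

/-! ### Excursions and their words. -/

/-- Nonempty excursions below the horizontal axis that never turn back vertically, given by their
first return decomposition. -/
inductive Excursion
  | flat
  | flatCons (e : Excursion)
  | arch (e : Excursion)
  | archFlat (e : Excursion)
  | archCons (e f : Excursion)
  deriving DecidableEq

namespace Excursion

/-- The steps of an excursion. -/
def word : Excursion → List Dir
  | flat => [.right]
  | flatCons e => .right :: e.word
  | arch e => .down :: (e.word ++ [.up])
  | archFlat e => .down :: (e.word ++ [.up, .right])
  | archCons e f => .down :: (e.word ++ .up :: .right :: f.word)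

/-- The number of horizontal steps plus the number of up steps. -/
def size : Excursion → ℕ
  | flat => 1
  | flatCons e => e.size + 1
  | arch e => e.size + 1
  | archFlat e => e.size + 2
  | archCons e f => e.size + f.size + 2

/-- The number of horizontal steps. -/
def width : Excursion → ℕ
  | flat => 1
  | flatCons e => e.width + 1
  | arch e => e.width
  | archFlat e => e.width + 1
  | archCons e f => e.width + f.width + 1

theorem one_le_size (e : Excursion) : 1 ≤ e.size := by
  cases e <;> simp [size]

/-- An excursion has as many down steps as up steps. This makes the half-perimeter of its loop equal
to `size + 1`. -/
theorem length_word_add_width (e : Excursion) : e.word.length + e.width = 2 * e.size := by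
  induction e <;> simp only [word, width, size, List.length_cons, List.length_append,
    List.length_nil] <;> omega

theorem endpoint_word (e : Excursion) : endpoint e.word = ((e.width : ℤ), 0) := by
  induction e <;>
    simp_all [word, width, endpoint_append, endpoint_cons, Dir.vec, add_comm]
  ring

theorem word_append_ne_up_cons (e : Excursion) (x y : List Dir) : e.word ++ x ≠ .up :: y := by
  cases e <;> simp [word]

/-- Words of excursions can be prefixes of one another; the following up step, the first to leave
the starting level upwards, marks where the word ends. -/
theorem word_append_up_inj {e f : Excursion} {x y : List Dir}
    (h : e.word ++ .up :: x = f.word ++ .up :: y) : e = f ∧ x = y := by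
  induction e generalizing f x y with
  | flat =>
    cases f <;> simp [word] at h ⊢
    · exact h
    · exact word_append_ne_up_cons _ _ _ h.symm
  | flatCons e ih =>
    cases f <;> simp [word] at h ⊢
    · exact word_append_ne_up_cons _ _ _ h
    · exact ih h
  | arch e ih =>
    cases f <;> simp [word] at h <;> obtain ⟨rfl, h⟩ := ih h <;> simp at h ⊢
    exact h
  | archFlat e ih =>
    cases f <;> simp [word] at h <;> obtain ⟨rfl, h⟩ := ih h <;> simp at h ⊢
    · exact h
    · exact word_append_ne_up_cons _ _ _ h.symm
  | archCons e e' ih ih' =>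
    cases f <;> simp [word] at h <;> obtain ⟨rfl, h⟩ := ih h <;> simp at h ⊢
    · exact word_append_ne_up_cons _ _ _ h
    · exact ih' h

theorem ne_left_of_mem_word (e : Excursion) : ∀ d ∈ e.word, d ≠ .left := by
  induction e <;> simp_all [word, or_imp]

theorem head?_word_ne_up (e : Excursion) : e.word.head? ≠ some .up := by
  cases e <;> simp [word]

theorem word_ne_nil (e : Excursion) : e.word ≠ [] := by
  cases e <;> simp [word]

theorem getLast?_word_ne_down (e : Excursion) : e.word.getLast? ≠ some .down := by
  induction e with
  | flatCons e ih =>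
    simpa [word, List.getLast?_cons,
      List.getLast?_eq_some_getLast e.word_ne_nil] using ih
  | archCons e f _ ih =>
    simpa [word, List.getLast?_cons, List.getLast?_append,
      List.getLast?_eq_some_getLast f.word_ne_nil] using ih
  | _ => simp [word, List.getLast?_cons, List.getLast?_append]

theorem isChain_word (e : Excursion) : e.word.IsChain NoVerticalReversal := by
  have hd (e : Excursion) (x : List Dir) (d : Dir) (h : d ≠ .up)
      (hc : (e.word ++ x).IsChain NoVerticalReversal) :
      (d :: (e.word ++ x)).IsChain NoVerticalReversal := by
    rw [List.isChain_cons]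
    refine ⟨fun y hy => ⟨by simp [h], ?_⟩, hc⟩
    rintro ⟨_, rfl⟩
    rw [List.head?_append_of_ne_nil _ e.word_ne_nil] at hy
    exact e.head?_word_ne_up hy
  have hu (e : Excursion) (x : List Dir) (he : e.word.IsChain NoVerticalReversal)
      (hx : (Dir.up :: x).IsChain NoVerticalReversal) :
      (e.word ++ .up :: x).IsChain NoVerticalReversal := by
    rw [List.isChain_append]
    refine ⟨he, hx, fun y hy z hz => ?_⟩
    simp at hz
    subst hz
    refine ⟨by simp, ?_⟩
    rintro ⟨rfl, _⟩
    exact e.getLast?_word_ne_down hy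
  induction e with
  | flat => simp [word]
  | flatCons e ih => simpa [word] using hd e [] .right (by simp) (by simpa using ih)
  | arch e ih => exact hd e _ _ (by simp) (hu e _ ih (by simp))
  | archFlat e ih => exact hd e _ _ (by simp) (hu e _ ih (by simp [NoVerticalReversal]))
  | archCons e f ih ih' =>
    refine hd e _ _ (by simp) (hu e _ ih ?_)
    rw [List.isChain_cons_cons]
    exact ⟨by simp [NoVerticalReversal],
      by simpa using hd f [] .right (by simp) (by simpa using ih')⟩

theorem snd_le_of_mem_visited_word (e : Excursion) : ∀ p ∈ visited e.word, p.2 ≤ 0 := by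
  -- The starting height `c` is generalized because the body of an arch starts one level lower.
  suffices h : ∀ c : ℤ, c ≤ 0 → ∀ p ∈ visited e.word, c + p.2 ≤ 0 by simpa using h 0 le_rfl
  induction e with
  | flat =>
    intro c hc'
    rw [word, forall_mem_visited_cons]
    simp [mem_visited_nil, Dir.vec, hc']
  | flatCons e ih =>
    intro c hc'
    rw [word, forall_mem_visited_cons]
    exact ⟨by simpa, by simpa [Dir.vec] using ih c hc'⟩
  | arch e ih =>
    intro c hc'
    rw [word, forall_mem_visited_cons, forall_mem_visited_append, forall_mem_visited_cons]
    refine ⟨by simpa, fun p hp => ?_, ?_⟩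
    · have := ih (c - 1) (by omega) p hp
      simp [Dir.vec]; omega
    · simp [mem_visited_nil, endpoint_word, Dir.vec]; omega
  | archFlat e ih =>
    intro c hc'
    rw [word, forall_mem_visited_cons, forall_mem_visited_append, forall_mem_visited_cons,
      forall_mem_visited_cons]
    refine ⟨by simpa, fun p hp => ?_, ?_⟩
    · have := ih (c - 1) (by omega) p hp
      simp [Dir.vec]; omega
    · simp [mem_visited_nil, endpoint_word, Dir.vec]; omega
  | archCons e f ih ih' =>
    intro c hc'
    rw [word, forall_mem_visited_cons, forall_mem_visited_append, forall_mem_visited_cons,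
      forall_mem_visited_cons]
    refine ⟨by simpa, fun p hp => ?_, ?_, ?_, fun p hp => ?_⟩
    · have := ih (c - 1) (by omega) p hp
      simp [Dir.vec]; omega
    · simp [endpoint_word, Dir.vec]; omega
    · simp [endpoint_word, Dir.vec]; omega
    · have := ih' c hc' p hp
      simp [endpoint_word, Dir.vec]; omega

/-- Cut at the first up step above the starting level. After a down step the recursion is applied
once for the arch and, if a right step follows, once more for the rest; vertical reversals being
excluded, the arch is nonempty and no down step follows it directly. -/
theorem exists_eq_word_append {w : List Dir} (hl : ∀ d ∈ w, d ≠ .left)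
    (hc : w.IsChain NoVerticalReversal) (hw : 0 < (endpoint w).2) :
    ∃ r, w = .up :: r ∨ ∃ e : Excursion, w = e.word ++ .up :: r := by
  induction hn : w.length using Nat.strong_induction_on generalizing w with
  | _ n ih =>
    rcases w with _ | ⟨d, w⟩
    · simp at hw
    have hl' : ∀ d ∈ w, d ≠ .left := fun d hd => hl d (by simp [hd])
    rw [List.isChain_cons] at hc
    rw [endpoint_cons] at hw
    cases d with
    | up => exact ⟨w, Or.inl rfl⟩
    | left => exact absurd rfl (hl .left (by simp))
    | right =>
      obtain ⟨r, rfl | ⟨e, rfl⟩⟩ :=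
        ih w.length (by simp at hn; omega) hl' hc.2 (by simpa [Dir.vec] using hw) rfl
      · exact ⟨r, Or.inr ⟨flat, rfl⟩⟩
      · exact ⟨r, Or.inr ⟨flatCons e, rfl⟩⟩
    | down =>
      simp only [Dir.vec, Prod.snd_add] at hw
      obtain ⟨r, rfl | ⟨e, rfl⟩⟩ :=
        ih w.length (by simp at hn; omega) hl' hc.2 (by omega) rfl
      · exact absurd ⟨rfl, rfl⟩ (hc.1 .up (by simp)).2
      have hcr := (List.isChain_append.1 hc.2).2.1
      rw [List.isChain_cons] at hcr
      simp only [endpoint_append, endpoint_word, endpoint_cons, Dir.vec, Prod.snd_add] at hw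
      rcases r with _ | ⟨d, r⟩
      · simp at hw
      cases d with
      | up => exact ⟨r, Or.inr ⟨arch e, by simp [word]⟩⟩
      | left => exact absurd rfl (hl' .left (by simp))
      | down => exact absurd ⟨rfl, rfl⟩ (hcr.1 .down (by simp)).1
      | right =>
        rw [endpoint_cons] at hw
        have hl'' : ∀ d ∈ r, d ≠ .left := fun d hd => hl' d (by simp [hd])
        obtain ⟨r', rfl | ⟨f, rfl⟩⟩ := ih r.length (by simp at hn; omega) hl''
          (List.isChain_cons.1 hcr.2).2 (by simp [Dir.vec] at hw; omega) rfl
        · exact ⟨r', Or.inr ⟨archFlat e, by simp [word]⟩⟩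
        · exact ⟨r', Or.inr ⟨archCons e f, by simp [word]⟩⟩

end Excursion

theorem IsRightward.exists_eq_word {w : List Dir} (hw : IsRightward w) {n : ℕ} (hn : 1 ≤ n)
    (he : endpoint w = ((n : ℤ), 0)) : ∃ e : Excursion, w = e.word ∧ e.width = n := by
  have hup (v r : List Dir) (h : w = v ++ .up :: r) (hv : (endpoint v).2 = 0) : False := by
    have hm : endpoint (v ++ [.up]) ∈ visited (v ++ [.up] ++ r) :=
      mem_visited_append_left (endpoint_mem_visited _)
    have h1 := hw.snd_le (endpoint (v ++ [.up])) (by simpa [h] using hm)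
    simp [Dir.vec, hv] at h1
  have hc : (w ++ [Dir.up]).IsChain NoVerticalReversal := by
    rw [List.isChain_append]
    refine ⟨hw.chain, by simp, ?_⟩
    simp only [List.head?_cons, Option.mem_some_iff, forall_eq']
    refine fun c hc => ⟨by simp, ?_⟩
    rintro ⟨rfl, _⟩
    obtain ⟨v, rfl⟩ := List.mem_getLast?_eq_getLast hc |>.elim fun hne h =>
      (⟨w.dropLast, by rw [h, List.dropLast_append_getLast]⟩ : ∃ v, w = v ++ [.down])
    have h1 := hw.snd_le _ (mem_visited_append_left (endpoint_mem_visited v))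
    simp [Prod.ext_iff, Dir.vec] at he
    omega
  -- The appended up step makes the final height positive. As `w` stays weakly below the axis, the
  -- factorization must cut exactly there.
  obtain ⟨r, h | ⟨e, h⟩⟩ := Excursion.exists_eq_word_append (w := w ++ [.up])
    (by simpa [or_imp, forall_and] using hw.ne_left) hc (by simp [he, Dir.vec])
  · rcases w with _ | ⟨d, w⟩
    · simp [Prod.ext_iff] at he
      omega
    · simp at h
      exact (hup [] w (by simp [h.1]) (by simp)).elim
  · rcases List.eq_nil_or_concat' r with rfl | ⟨r, d, rfl⟩
    · have h' : w = e.word := by simpa using h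
      refine ⟨e, h', ?_⟩
      rw [h', e.endpoint_word] at he
      simpa using he
    · rw [← List.cons_append, ← List.append_assoc] at h
      exact (hup e.word r (List.append_inj_left' h rfl) (by simp [e.endpoint_word])).elim

/-! ### Hooks and loops are two-sided prudent. -/

theorem isTwoSidedPrudent_of_isChain {w : List Dir} (hl : ∀ d ∈ w, d ≠ .left)
    (hc : w.IsChain NoVerticalReversal) : IsTwoSidedPrudent w := by
  -- Strengthened induction: the endpoint is in the last column, is its highest vertex unless the
  -- last step was down, and its lowest unless the last step was up. So the next step meets nothing.
  suffices h : IsTwoSidedPrudent w ∧ (∀ p ∈ visited w, p.1 ≤ (endpoint w).1) ∧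
      (w.getLast? ≠ some .down → ∀ p ∈ visited w, p.1 = (endpoint w).1 → p.2 ≤ (endpoint w).2) ∧
      (w.getLast? ≠ some .up → ∀ p ∈ visited w, p.1 = (endpoint w).1 → (endpoint w).2 ≤ p.2) from
    h.1
  induction w using List.reverseRecOn with
  | nil => simp [isTwoSidedPrudent_nil, mem_visited_nil]
  | append_singleton w d ih =>
    rw [List.isChain_append] at hc
    obtain ⟨hg, hx, hdown, hup⟩ := ih (fun d hd => hl d (by simp [hd])) hc.1
    have hlast : ∀ c, w.getLast? = some c → NoVerticalReversal c d :=
      fun c h => hc.2.2 c h d (by simp)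
    simp only [isTwoSidedPrudent_append_iff, mem_visited_append_singleton, or_imp, forall_and,
      forall_eq, endpoint_append_singleton, List.getLast?_concat, hg, true_and]
    cases d with
    | left => exact absurd rfl (hl .left (by simp))
    | up =>
      have hd := hdown fun h => (hlast _ h).2 ⟨rfl, rfl⟩
      refine ⟨⟨fun q hq h => ?_, Or.inr fun q hq => ?_⟩, ⟨fun q hq => ?_, le_rfl⟩,
        ⟨fun _ q hq h => ?_, fun _ _ => le_rfl⟩, by simp⟩ <;>
      simp [Dir.Ahead, Dir.vec] at *
      · have := hd _ _ hq h.1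
        omega
      · exact hx _ _ hq
      · exact hx _ _ hq
      · have := hd _ _ hq h
        omega
    | down =>
      have hd := hup fun h => (hlast _ h).1 ⟨rfl, rfl⟩
      refine ⟨⟨fun q hq h => ?_, Or.inr fun q hq => ?_⟩, ⟨fun q hq => ?_, le_rfl⟩, by simp,
        ⟨fun _ q hq h => ?_, fun _ _ => le_rfl⟩⟩ <;>
      simp [Dir.Ahead, Dir.vec] at *
      · have := hd _ _ hq h.1
        omega
      · exact hx _ _ hq
      · exact hx _ _ hq
      · have := hd _ _ hq h
        omega
    | right =>
      refine ⟨⟨fun q hq h => ?_, Or.inr fun q hq => ?_⟩, ⟨fun q hq => ?_, le_rfl⟩,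
        ⟨fun _ q hq h => ?_, fun _ _ => le_rfl⟩,
        ⟨fun _ q hq h => ?_, fun _ _ => le_rfl⟩⟩ <;>
      have := hx q hq <;> simp [Dir.Ahead, Dir.vec] at * <;> omega

theorem IsTwoSidedPrudent.append_replicate_left {w : List Dir} (hw : IsTwoSidedPrudent w)
    (htop : ∀ q ∈ visited w, q.2 ≤ (endpoint w).2)
    (hleft : ∀ q ∈ visited w, q.2 = (endpoint w).2 → (endpoint w).1 ≤ q.1) (n : ℕ) :
    IsTwoSidedPrudent (w ++ List.replicate n .left) := by
  induction n generalizing w with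
  | zero => simpa
  | succ n ih =>
    rw [List.replicate_succ, ← List.singleton_append, ← List.append_assoc]
    refine ih (isTwoSidedPrudent_append_iff.2 ⟨hw, fun q hq h => ?_, Or.inl fun q hq => ?_⟩) ?_ ?_
    · exact absurd (hleft q hq h.1) (by have := h.2; omega)
    · simpa [Dir.vec] using htop q hq
    · simpa [mem_visited_append_singleton, or_imp, forall_and, Dir.vec] using htop
    · simp only [mem_visited_append_singleton, or_imp, forall_and, forall_eq,
        endpoint_append_singleton]
      refine ⟨fun q hq h => ?_, fun _ => le_rfl⟩
      have := hleft q hq (by simpa [Dir.vec] using h)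
      simp [Dir.vec]
      omega

theorem IsTwoSidedPrudent.append_replicate_right {w : List Dir} (hw : IsTwoSidedPrudent w)
    (htop : ∀ q ∈ visited w, q.2 ≤ (endpoint w).2)
    (hright : ∀ q ∈ visited w, q.2 = (endpoint w).2 → q.1 ≤ (endpoint w).1) (n : ℕ) :
    IsTwoSidedPrudent (w ++ List.replicate n .right) := by
  induction n generalizing w with
  | zero => simpa
  | succ n ih =>
    rw [List.replicate_succ, ← List.singleton_append, ← List.append_assoc]
    refine ih (isTwoSidedPrudent_append_iff.2 ⟨hw, fun q hq h => ?_, Or.inl fun q hq => ?_⟩) ?_ ?_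
    · exact absurd (hright q hq h.1) (by have := h.2; omega)
    · simpa [Dir.vec] using htop q hq
    · simpa [mem_visited_append_singleton, or_imp, forall_and, Dir.vec] using htop
    · simp only [mem_visited_append_singleton, or_imp, forall_and, forall_eq,
        endpoint_append_singleton]
      refine ⟨fun q hq h => ?_, fun _ => le_rfl⟩
      have := hright q hq (by simpa [Dir.vec] using h)
      simp [Dir.vec]
      omega

/-- An up step from a vertex on the top side of the box. -/
theorem IsTwoSidedPrudent.append_up {w : List Dir} (hw : IsTwoSidedPrudent w)
    (htop : ∀ q ∈ visited w, q.2 ≤ (endpoint w).2) :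
    IsTwoSidedPrudent (w ++ [.up]) ∧
      (∀ q ∈ visited (w ++ [.up]), q.2 ≤ (endpoint (w ++ [.up])).2) ∧
      ∀ q ∈ visited (w ++ [.up]), q.2 = (endpoint (w ++ [.up])).2 →
        q = endpoint (w ++ [.up]) := by
  refine ⟨isTwoSidedPrudent_append_iff.2 ⟨hw, fun q hq h => ?_, Or.inl fun q hq => ?_⟩, ?_, ?_⟩
  · exact absurd (htop q hq) (by have := h.2; omega)
  · have := htop q hq
    simp [Dir.vec]
    omega
  · simp only [mem_visited_append_singleton, or_imp, forall_and, forall_eq,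
      endpoint_append_singleton]
    refine ⟨fun q hq => ?_, le_rfl⟩
    have := htop q hq
    simp [Dir.vec]
    omega
  · simp only [mem_visited_append_singleton, or_imp, forall_and, forall_eq,
      endpoint_append_singleton]
    refine ⟨fun q hq h => ?_, fun _ => trivial⟩
    have := htop q hq
    simp [Dir.vec] at h
    omega

/-- The polygon of height one whose walk starts to the left. -/
def hook (a : ℕ) : List Dir := List.replicate a .left ++ [.up] ++ List.replicate a .right

/-- The bargraph polygon that hangs from the line of ordinate `1` and follows an excursion. -/
def Excursion.loop (e : Excursion) : List Dir :=
  e.word ++ [.up] ++ List.replicate e.width .left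

theorem endpoint_hook (a : ℕ) : endpoint (hook a) = (0, 1) := by
  simp [hook, endpoint_append, endpoint_replicate, endpoint_cons, Dir.vec]

theorem length_hook (a : ℕ) : (hook a).length = 2 * a + 1 := by
  simp [hook]
  omega

theorem isTwoSidedPrudent_hook (a : ℕ) : IsTwoSidedPrudent (hook a) := by
  have hl : IsTwoSidedPrudent ([] ++ List.replicate a .left) :=
    isTwoSidedPrudent_nil.append_replicate_left (by simp [mem_visited_nil])
      (by simp [mem_visited_nil]) a
  rw [List.nil_append] at hl
  have htop : ∀ q ∈ visited (List.replicate a Dir.left), q.2 ≤ 0 := by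
    clear hl
    induction a with
    | zero => simp [mem_visited_nil]
    | succ a ih =>
      simp only [List.replicate_succ', mem_visited_append_singleton, or_imp, forall_and, forall_eq]
      exact ⟨ih, by simp [endpoint_replicate, Dir.vec]⟩
  obtain ⟨hg, h1, h2⟩ := hl.append_up (by simpa [endpoint_replicate, Dir.vec] using htop)
  exact hg.append_replicate_right h1 (fun q hq h => (congrArg Prod.fst (h2 q hq h)).le) a

theorem Excursion.endpoint_loop (e : Excursion) : endpoint e.loop = (0, 1) := by
  simp [loop, endpoint_append, endpoint_replicate, endpoint_cons, endpoint_word, Dir.vec]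

theorem Excursion.length_loop (e : Excursion) : e.loop.length = 2 * e.size + 1 := by
  have := e.length_word_add_width
  simp [loop]
  omega

theorem Excursion.isTwoSidedPrudent_loop (e : Excursion) : IsTwoSidedPrudent e.loop := by
  obtain ⟨hg, h1, h2⟩ :=
    (isTwoSidedPrudent_of_isChain e.ne_left_of_mem_word e.isChain_word).append_up
      (by simpa [endpoint_word] using e.snd_le_of_mem_visited_word)
  exact hg.append_replicate_left h1 (fun q hq h => (congrArg Prod.fst (h2 q hq h)).ge) _

theorem Excursion.loop_injective : Function.Injective Excursion.loop := by
  intro e f h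
  simp only [loop, List.append_assoc, List.singleton_append] at h
  exact (word_append_up_inj h).1

theorem Excursion.loop_ne_hook (e : Excursion) {a : ℕ} (ha : 1 ≤ a) : e.loop ≠ hook a := by
  obtain ⟨a, rfl⟩ := Nat.exists_eq_add_of_le' ha
  cases e <;> simp [loop, hook, word, List.replicate_succ]

/-! ### Polygons above the origin and the diagonal symmetry. -/

/-- Two-sided prudent polygons of half-perimeter `m` whose last vertex lies above the origin. -/
def upperPolygons (m : ℕ) : Set (List Dir) :=
  {w | IsTwoSidedPrudent w ∧ w.length ≠ 1 ∧ endpoint w = (0, 1) ∧ w.length + 1 = 2 * m}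

theorem upperPolygons_zero : upperPolygons 0 = ∅ := by
  ext w
  simp [upperPolygons]

theorem upperPolygons_one : upperPolygons 1 = ∅ := by
  ext w
  simp only [upperPolygons, Set.mem_ofPred_eq, Set.mem_empty_iff_false, iff_false]
  rintro ⟨-, h, -, h'⟩
  omega

theorem upperPolygons_add_two (k : ℕ) :
    upperPolygons (k + 2) =
      insert (hook (k + 1)) (Excursion.loop '' {e | e.size = k + 1}) := by
  ext w
  simp only [upperPolygons, Set.mem_ofPred_eq, Set.mem_insert_iff, Set.mem_image]
  constructor
  · rintro ⟨hg, hlen, hend, hm⟩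
    rcases hg.eq_of_endpoint_eq hend hlen with ⟨a, ha, h⟩ | ⟨e, n, hr, hn, he, h⟩
    · change w = hook a at h
      have := length_hook a
      rw [← h] at this
      obtain rfl : a = k + 1 := by omega
      exact Or.inl h
    · obtain ⟨e, rfl, rfl⟩ := hr.exists_eq_word hn he
      change w = e.loop at h
      have := e.length_loop
      rw [← h] at this
      exact Or.inr ⟨e, by omega, h.symm⟩
  · rintro (rfl | ⟨e, he, rfl⟩)
    · refine ⟨isTwoSidedPrudent_hook _, ?_, endpoint_hook _, ?_⟩ <;> rw [length_hook] <;> omega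
    · refine ⟨e.isTwoSidedPrudent_loop, ?_, e.endpoint_loop, ?_⟩ <;> rw [e.length_loop] <;> omega

/-- The reflection of steps in the diagonal. -/
def Dir.swap : Dir → Dir
  | .up => .right
  | .down => .left
  | .left => .down
  | .right => .up

@[simp]
theorem Dir.swap_swap (d : Dir) : d.swap.swap = d := by cases d <;> rfl

theorem map_swap_map_swap (w : List Dir) : (w.map Dir.swap).map Dir.swap = w := by
  simp [Function.comp_def]

theorem map_swap_injective : Function.Injective (List.map Dir.swap) :=
  Function.LeftInverse.injective map_swap_map_swap

theorem Dir.vec_swap (d : Dir) : d.swap.vec = d.vec.swap := by cases d <;> rfl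

theorem endpoint_map_swap (w : List Dir) : endpoint (w.map Dir.swap) = (endpoint w).swap := by
  induction w with
  | nil => simp
  | cons d w ih =>
    rw [List.map_cons, endpoint_cons, endpoint_cons, ih, Dir.vec_swap]
    rfl

theorem mem_visited_map_swap {w : List Dir} {p : ℤ × ℤ} :
    p ∈ visited (w.map Dir.swap) ↔ p.swap ∈ visited w := by
  induction w using List.reverseRecOn with
  | nil => simp [mem_visited_nil, Prod.ext_iff, and_comm]
  | append_singleton w d ih =>
    rw [List.map_append, List.map_singleton, mem_visited_append_singleton,
      mem_visited_append_singleton, ih, endpoint_map_swap, Dir.vec_swap, ← Prod.swap_add,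
      ← Prod.swap_inj, Prod.swap_swap]

theorem IsTwoSidedPrudent.map_swap {w : List Dir} (hw : IsTwoSidedPrudent w) :
    IsTwoSidedPrudent (w.map Dir.swap) := by
  induction w using List.reverseRecOn with
  | nil => exact hw
  | append_singleton w d ih =>
    rw [List.map_append, List.map_singleton]
    obtain ⟨hg, hray, hbox⟩ := isTwoSidedPrudent_append_iff.1 hw
    refine isTwoSidedPrudent_append_iff.2 ⟨ih hg, fun q hq => ?_, ?_⟩
    · have := hray _ (mem_visited_map_swap.1 hq)
      rw [endpoint_map_swap]
      cases d <;> simpa [Dir.swap, Dir.Ahead] using this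
    · rw [endpoint_map_swap, Dir.vec_swap]
      refine hbox.symm.imp (fun h q hq => ?_) (fun h q hq => ?_) <;>
      · have := h _ (mem_visited_map_swap.1 hq)
        simpa using this

/-- Reflection in the diagonal exchanges the top and right sides, so it preserves the class;
endpoints `(0, -1)` and `(-1, 0)` do not occur. -/
theorem twoSidedPolygons_eq (m : ℕ) :
    twoSidedPolygons m = upperPolygons m ∪ List.map Dir.swap '' upperPolygons m := by
  ext w
  simp only [twoSidedPolygons, IsTwoSidedPolygon, Set.mem_ofPred_eq, Set.mem_union, Set.mem_image]
  change ((IsPrudent w ∧ IsTwoSided w ∧ w.length ≠ 1 ∧ Adj (vertex w 0) (endpoint w)) ∧ _) ↔ _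
  rw [vertex_zero]
  constructor
  · rintro ⟨⟨hp, ht, hlen, d, hd⟩, hm⟩
    have hg : IsTwoSidedPrudent w := ⟨hp, ht⟩
    rw [zero_add] at hd
    cases d with
    | up => exact Or.inl ⟨hg, hlen, hd, hm⟩
    | down => exact absurd hd (hg.endpoint_ne_down hlen)
    | left =>
      refine absurd ?_ (hg.map_swap.endpoint_ne_down (by simpa using hlen))
      rw [endpoint_map_swap, hd]
      rfl
    | right =>
      refine Or.inr ⟨w.map Dir.swap, ⟨hg.map_swap, by simpa using hlen, ?_, by simpa using hm⟩,
        map_swap_map_swap w⟩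
      rw [endpoint_map_swap, hd]
      rfl
  · rintro (⟨hg, hlen, hd, hm⟩ | ⟨w, ⟨hg, hlen, hd, hm⟩, rfl⟩)
    · exact ⟨⟨hg.1, hg.2, hlen, .up, by simp [hd, Dir.vec]⟩, hm⟩
    · refine ⟨⟨hg.map_swap.1, hg.map_swap.2, by simpa using hlen, .right, ?_⟩, by simpa using hm⟩
      simp [endpoint_map_swap, hd, Dir.vec]

theorem ncard_twoSidedPolygons (m : ℕ) :
    (twoSidedPolygons m).ncard = 2 * (upperPolygons m).ncard := by
  have hfin : (upperPolygons m).Finite :=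
    (finite_twoSidedPolygons m).subset (twoSidedPolygons_eq m ▸ Set.subset_union_left)
  rw [twoSidedPolygons_eq, Set.ncard_union_eq _ hfin (hfin.image _),
    Set.ncard_image_of_injective _ map_swap_injective, two_mul]
  rw [Set.disjoint_left]
  rintro _ h ⟨w, hw, rfl⟩
  have h1 := h.2.2.1
  rw [endpoint_map_swap, hw.2.2.1] at h1
  simp at h1

/-! ### Generating functions. -/

open PowerSeries

namespace Excursion

/-- The excursions of a given size. -/
def ofSize : ℕ → Finset Excursion
  | 0 => ∅
  | 1 => {flat}
  | k + 2 =>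
    (((ofSize (k + 1)).image flatCons ∪ (ofSize (k + 1)).image arch) ∪
      (ofSize k).image archFlat) ∪
      -- `attach` keeps the proof that the two sizes add up to `k`, needed for termination.
      (Finset.HasAntidiagonal.antidiagonal k).attach.biUnion fun ij =>
        have := Finset.HasAntidiagonal.mem_antidiagonal.1 ij.2
        (ofSize ij.1.1 ×ˢ ofSize ij.1.2).image fun p => archCons p.1 p.2

theorem mem_ofSize {k : ℕ} {e : Excursion} : e ∈ ofSize k ↔ e.size = k := by
  induction k using Nat.strong_induction_on generalizing e with
  | _ k ih =>
    rcases k with _ | _ | k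
    · have := e.one_le_size
      simp only [ofSize, Finset.notMem_empty, false_iff]
      omega
    · cases e <;> simp [ofSize, size]
      all_goals
        rename_i e
        have := e.one_le_size
        omega
    · simp only [ofSize, Finset.mem_union, Finset.mem_image, Finset.mem_biUnion,
        Finset.mem_attach, true_and, Subtype.exists, Finset.mem_product, Prod.exists,
        Finset.HasAntidiagonal.mem_antidiagonal]
      cases e with
      | flat => simp [size]
      | flatCons e => simp [size, ih]
      | arch e => simp [size, ih]
      | archFlat e => simp [size, ih]
      | archCons e f =>
        simp only [reduceCtorEq, and_false, exists_false, false_or, archCons.injEq, size]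
        constructor
        · rintro ⟨i, j, hij, e', f', ⟨he, hf⟩, rfl, rfl⟩
          rw [ih i (by omega)] at he
          rw [ih j (by omega)] at hf
          omega
        · intro h
          exact ⟨e.size, f.size, by omega, e, f,
            ⟨(ih _ (by omega)).2 rfl, (ih _ (by omega)).2 rfl⟩, rfl, rfl⟩

theorem card_ofSize_add_two (k : ℕ) :
    (ofSize (k + 2)).card = 2 * (ofSize (k + 1)).card + (ofSize k).card +
      ∑ ij ∈ Finset.HasAntidiagonal.antidiagonal k, (ofSize ij.1).card * (ofSize ij.2).card := by
  rw [ofSize, Finset.card_union_of_disjoint, Finset.card_union_of_disjoint,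
    Finset.card_union_of_disjoint, Finset.card_image_of_injective _ fun _ _ h => by simpa using h,
    Finset.card_image_of_injective _ fun _ _ h => by simpa using h,
    Finset.card_image_of_injective _ fun _ _ h => by simpa using h, Finset.card_biUnion,
    ← Finset.sum_attach (Finset.HasAntidiagonal.antidiagonal k), two_mul]
  · congr 1
    refine Finset.sum_congr rfl fun ij _ => ?_
    rw [Finset.card_image_of_injective, Finset.card_product]
    rintro ⟨a, b⟩ ⟨c, d⟩ h
    simpa using h
  · rintro ⟨⟨i, j⟩, hij⟩ _ ⟨⟨i', j'⟩, hij'⟩ _ hne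
    rw [Function.onFun, Finset.disjoint_left]
    simp only [Finset.mem_image, Finset.mem_product, Prod.exists, mem_ofSize]
    rintro _ ⟨a, b, ⟨rfl, rfl⟩, rfl⟩ ⟨c, d, ⟨rfl, rfl⟩, h⟩
    obtain ⟨rfl, rfl⟩ := by simpa using h
    exact hne rfl
  all_goals
    rw [Finset.disjoint_left]
    simp only [Finset.mem_union, Finset.mem_image, Finset.mem_biUnion]
    rintro _ h h'
    first
    | obtain ⟨_, _, rfl⟩ := h'
      simp at h
    | obtain ⟨_, _, _, _, rfl⟩ := h'
      simp at h

/-- The generating function of excursions by size. -/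
noncomputable def series : PowerSeries ℚ := mk fun k => ((ofSize k).card : ℚ)

theorem series_eq : series = X + (2 * X + X ^ 2) * series + X ^ 2 * series ^ 2 := by
  -- Factors `X` are pulled out one at a time so that each one shifts the coefficient index.
  have h : series = X + 2 * (X * series) + X * (X * (series + series * series)) := by
    ext k
    rcases k with _ | _ | k
    · simp [series, ofSize]
    · simp [series, ofSize, coeff_succ_X_mul, ← map_ofNat (C (R := ℚ)), coeff_C_mul]
    · rw [map_add, map_add, ← map_ofNat (C (R := ℚ)), coeff_C_mul, coeff_succ_X_mul,
        coeff_succ_X_mul, coeff_succ_X_mul, map_add, coeff_mul, coeff_X, if_neg (by omega)]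
      simp only [series, coeff_mk, card_ofSize_add_two]
      push_cast
      ring
  linear_combination h

end Excursion

theorem coeff_zero_PP₂ : coeff 0 PP₂ = 0 := by
  rw [PP₂, coeff_mk, ncard_twoSidedPolygons, upperPolygons_zero]
  simp

theorem coeff_one_PP₂ : coeff 1 PP₂ = 0 := by
  rw [PP₂, coeff_mk, ncard_twoSidedPolygons, upperPolygons_one]
  simp

theorem coeff_add_two_PP₂ (k : ℕ) :
    coeff (k + 2) PP₂ = 2 * (coeff (k + 1) Excursion.series + 1) := by
  have hset : {e : Excursion | e.size = k + 1} = (Excursion.ofSize (k + 1) : Set Excursion) := by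
    ext e
    simp [Excursion.mem_ofSize]
  rw [PP₂, coeff_mk, ncard_twoSidedPolygons, upperPolygons_add_two, hset,
    Set.ncard_insert_of_notMem, Set.ncard_image_of_injective _ Excursion.loop_injective,
    Set.ncard_coe_finset]
  · simp [Excursion.series]
  · rintro ⟨e, _, h⟩
    exact e.loop_ne_hook (by omega) h

/-- The two terms count loops and hooks; the factor `2` is the diagonal symmetry. -/
theorem PP₂_eq : PP₂ = 2 * X * Excursion.series + 2 * X ^ 2 * (1 - X)⁻¹ := by
  have hinv : (1 - X : PowerSeries ℚ)⁻¹ = mk 1 := by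
    rw [PowerSeries.inv_eq_iff_mul_eq_one (by simp)]
    exact mk_one_mul_one_sub_eq_one ℚ
  have h : PP₂ = C 2 * (X * (Excursion.series + X * mk 1)) := by
    ext m
    rw [coeff_C_mul]
    rcases m with _ | _ | k
    · simp [coeff_zero_PP₂]
    · simp [coeff_one_PP₂, coeff_succ_X_mul, Excursion.series, Excursion.ofSize]
    · simp [coeff_add_two_PP₂, coeff_succ_X_mul]
  rw [h, hinv, map_ofNat]
  ring

/-! ### The first coefficients. -/

/-- Subtracting the two quadratics factors the residual of `Q` as `series - Q` times a series with
constant term `1`, which is a unit. An approximate root is thus correct to the order of its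
residual. -/
theorem Excursion.series_quadratic_unique_mod {n : ℕ} {Q : PowerSeries ℚ}
    (hQ : X ^ n ∣ X + (2 * X + X ^ 2) * Q + X ^ 2 * Q ^ 2 - Q) : X ^ n ∣ series - Q := by
  have hunit : IsUnit (1 - 2 * X - X ^ 2 - X ^ 2 * (series + Q) : PowerSeries ℚ) := by
    rw [isUnit_iff_constantCoeff]
    simp
  rw [← hunit.dvd_mul_right]
  convert hQ using 1
  linear_combination series_eq

/-- The excursion series up to order `20`. -/
noncomputable def excursionTrunc : PowerSeries ℚ :=
      X + 2 * X ^ 2 + 5 * X ^ 3 + 13 * X ^ 4 + 35 * X ^ 5 + 97 * X ^ 6 + 275 * X ^ 7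
      + 794 * X ^ 8 + 2327 * X ^ 9 + 6905 * X ^ 10 + 20705 * X ^ 11 + 62642 * X ^ 12
      + 190987 * X ^ 13 + 586219 * X ^ 14 + 1810011 * X ^ 15 + 5617914 * X ^ 16
      + 17518463 * X ^ 17 + 54857506 * X ^ 18 + 172431935 * X ^ 19

theorem X_pow_dvd_series_sub_excursionTrunc : X ^ 20 ∣ Excursion.series - excursionTrunc := by
  -- The witness is the residual of the truncation divided by `X ^ 20`.
  refine Excursion.series_quadratic_unique_mod ⟨
      543861219 + 633015543 * X + 1474529985 * X ^ 2 + 3641358676 * X ^ 3 + 9575840597 * X ^ 4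
      + 25645786636 * X ^ 5 + 69621261114 * X ^ 6 + 190787710698 * X ^ 7
      + 525938053795 * X ^ 8 + 1454382372904 * X ^ 9 + 4024384531431 * X ^ 10
      + 11115740223356 * X ^ 11 + 30567567270469 * X ^ 12 + 83433387538286 * X ^ 13
      + 225159719736900 * X ^ 14 + 597585568685026 * X ^ 15 + 1547473446009907 * X ^ 16
      + 3859453941633736 * X ^ 17 + 9050830911171846 * X ^ 18 + 18918371817708220 * X ^ 19
      + 29732772207844225 * X ^ 20, ?_⟩
  rw [excursionTrunc]
  ring

theorem coeff_series_of_lt {k : ℕ} (hk : k < 20) :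
    coeff k Excursion.series = coeff k excursionTrunc := by
  rw [← sub_eq_zero, ← map_sub]
  exact X_pow_dvd_iff.1 X_pow_dvd_series_sub_excursionTrunc k hk

theorem coeff_PP₂_of_lt {k : ℕ} (hk : k < 21) :
    coeff k PP₂ = ([0, 0, 4, 6, 12, 28, 72, 196, 552, 1590, 4656, 13812, 41412, 125286, 381976,
      1172440, 3620024, 11235830, 35036928, 109715014, 344863872] : List ℚ).getD k 0 := by
  rcases k with _ | _ | k
  · exact coeff_zero_PP₂
  · exact coeff_one_PP₂
  · rw [coeff_add_two_PP₂, coeff_series_of_lt (by omega)]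
    simp only [excursionTrunc, map_add, ← map_ofNat (C (R := ℚ)), coeff_C_mul, coeff_X_pow,
      coeff_X]
    have hk' : k < 19 := by omega
    clear hk
    interval_cases k <;> norm_num

end PrudentWalk

theorem mainTheorem3 :
    -- the formal power series `√((1 - t)(1 - 3t - t² - t³))` with constant term `1`
    (∃! S : PowerSeries ℚ,
      S ^ 2 = (1 - PowerSeries.X) *
          (1 - 3 * PowerSeries.X - PowerSeries.X ^ 2 - PowerSeries.X ^ 3) ∧
        PowerSeries.constantCoeff S = 1) ∧
    (∀ S : PowerSeries ℚ,
      S ^ 2 = (1 - PowerSeries.X) *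
          (1 - 3 * PowerSeries.X - PowerSeries.X ^ 2 - PowerSeries.X ^ 3) →
      PowerSeries.constantCoeff S = 1 →
      PowerSeries.X * PrudentWalk.PP₂ =
        (1 - 3 * PowerSeries.X + PowerSeries.X ^ 2 + 3 * PowerSeries.X ^ 3) *
          (1 - PowerSeries.X)⁻¹ - S) ∧
    (List.range 21).map (fun m => PowerSeries.coeff m PrudentWalk.PP₂) =
      [0, 0, 4, 6, 12, 28, 72, 196, 552, 1590, 4656, 13812, 41412, 125286, 381976, 1172440,
        3620024, 11235830, 35036928, 109715014, 344863872] := by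
  have hI : (1 - PowerSeries.X : PowerSeries ℚ) * (1 - PowerSeries.X)⁻¹ = 1 :=
    PowerSeries.mul_inv_cancel _ (by simp)
  have hN := PrudentWalk.Excursion.series_eq
  have hP := PrudentWalk.PP₂_eq
  set N := PrudentWalk.Excursion.series
  -- The root of the discriminant, isolated from the quadratic formula for `N`.
  set S₀ : PowerSeries ℚ :=
    1 - 2 * PowerSeries.X - PowerSeries.X ^ 2 - 2 * PowerSeries.X ^ 2 * N with hS₀
  have hsq : S₀ ^ 2 = (1 - PowerSeries.X) *
      (1 - 3 * PowerSeries.X - PowerSeries.X ^ 2 - PowerSeries.X ^ 3) := by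
    rw [hS₀]
    linear_combination (-4 * PowerSeries.X ^ 2) * hN
  have hconst : PowerSeries.constantCoeff S₀ = 1 := by simp [hS₀]
  have huniq : ∀ S : PowerSeries ℚ, S ^ 2 = (1 - PowerSeries.X) *
      (1 - 3 * PowerSeries.X - PowerSeries.X ^ 2 - PowerSeries.X ^ 3) →
      PowerSeries.constantCoeff S = 1 → S = S₀ := by
    intro S hS hc
    rcases sq_eq_sq_iff_eq_or_eq_neg.1 (hS.trans hsq.symm) with h | h
    · exact h
    · rw [h, map_neg, hconst] at hc
      norm_num at hc
  refine ⟨⟨S₀, ⟨hsq, hconst⟩, fun S hS => huniq S hS.1 hS.2⟩, fun S hS hc => ?_, ?_⟩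
  · rw [huniq S hS hc, hP, hS₀]
    -- The numerator equals `(1 - X)(1 - 2X - X²) + 2X³`, the last term coming from the hooks.
    linear_combination (-(1 - 2 * PowerSeries.X - PowerSeries.X ^ 2)) * hI
  · rw [List.map_congr_left fun k hk => PrudentWalk.coeff_PP₂_of_lt (List.mem_range.1 hk)]
    rfl
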